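/- Let $d\ge 1$, $\alpha\in(0,1)$, $\lambda>0$ and $p,q\ge 0$ with $p+q=1$. Let $E_\alpha$ be a reciprocal gamma variable, $P\{E_\alpha\in dx\}=\frac{x^{-\alpha-1}}{\Gamma(\alpha)}e^{-1/x}\,dx$ on $(0,\infty)$. For $\gamma>0$ let $\mathbf Y$ be a centred normal vector in $\mathbb R^d$ with random covariance $\sigma^2 I_d$, where $\sigma^2\sim\frac{\gamma}{2}E_\alpha$; that is, $\mathbf Y\sim\sqrt{\tfrac{\gamma}{2}E_\alpha}\,G$ with $G\sim N(0,I_d)$ independent of $E_\alpha$. Let $\mathbf Y_0,\mathbf Y_1,\dots$ be i.i.d. copies of $\mathbf Y$, let $\epsilon_0,\epsilon_1,\dots$ be i.i.d. with $P\{\epsilon_j=1\}=p$ and $P\{\epsilon_j=-1\}=q$, let $N$ be a Poisson process of rate $\lambda$, all of these being independent, and set $$\mathbf A(t)=\mathbf A^{(\gamma)}(t)=\sum_{j=0}^{N(t)}\epsilon_j\mathbf Y_j .$$ Let $\mathfrak S^{2\alpha}$ be the isotropic $2\alpha$-stable Lévy process in $\mathbb R^d$ with $\mathbb E\,e^{i\xi\cdot\mathfrak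 S^{2\alpha}(t)}=e^{-t|\xi|^{2\alpha}}$. Then the following hold. (i) For every $\gamma>0$, $\mathbf Y$ has the density $$\nu_{\mathbf Y}(y)=\frac{\Gamma(\alpha+\frac d2)}{\pi^{d/2}\,\Gamma(\alpha)}\;\frac{\gamma^\alpha}{(|y|^2+\gamma)^{\alpha+d/2}},\qquad y\in\mathbb R^d .$$ (ii) The integral $C=\int_{\mathbb R^d}\frac{1-\cos y_1}{|y|^{2\alpha+d}}\,dy$ converges, and with $t^*=\lambda\,\frac{\Gamma(\alpha+\frac d2)}{\pi^{d/2}\,\Gamma(\alpha)}\,C\,t$ the process $t\mapsto\mathbf A^{(\gamma)}(t/\gamma^\alpha)$ converges in distribution to $t\mapsto\mathfrak S^{2\alpha}(t^*)$ as $\gamma\downarrow 0$, in the sense of finite-dimensional distributions: for all $k$ and all times $t_1,\dots,t_k\ge 0$, $$\big(\mathbf A^{(\gamma)}(t_i/\gamma^\alpha)\big)_{i\le k}\;\xrightarrow{\;d\;}\;\big(\mathfrak S^{2\alpha}(t_i^*)\big)_{i\le k}.$$ (iii) Every (complex-valued) Schwartz function $f$ on $\mathbb R^d$ lies in the domain of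 the infinitesimal generator $\mathcal A$ of the limit process $\mathfrak S^{2\alpha}(t^*)$, and $$\mathcal A f=-\lambda\,\frac{\Gamma(\alpha+\frac d2)}{\pi^{d/2}\,\Gamma(\alpha)}\,C\,(-\Delta)^\alpha f ,$$ that is, $\frac1h\big(\mathbb E f(x+\mathfrak S^{2\alpha}(h^*))-f(x)\big)$ converges to the right-hand side uniformly in $x\in\mathbb R^d$ as $h\downarrow0$. Here $(-\Delta)^\alpha$ is the Fourier multiplier with symbol $|\xi|^{2\alpha}$ (for the Fourier transform with kernel $e^{i\xi\cdot x}$). -/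

import Mathlib

open MeasureTheory ProbabilityTheory Filter Topology
open scoped NNReal ENNReal FourierTransform SchwartzMap

noncomputable section

/-- The law on `ℝ` of the reciprocal gamma random variable `E_α`: it has density
`x ^ (-α - 1) / Γ(α) * exp (-1 / x)` on `(0, ∞)`. -/
def reciprocalGamma (α : ℝ) : Measure ℝ :=
  (volume.restrict (Set.Ioi 0)).withDensity
    (fun x => ENNReal.ofReal (x ^ (-α - 1) / Real.Gamma α * Real.exp (-1 / x)))

/-- The law on `ℝ^d` of a centred normal vector `Y` with random variance `(γ / 2) E_α`: the law of
`√((γ / 2) E) G`, where `E` is reciprocal gamma and `G` is standard normal, independent of `E`. -/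
def jumpLaw (d : ℕ) (α : ℝ) (γ : ℝ≥0) : Measure (EuclideanSpace ℝ (Fin d)) :=
  ((reciprocalGamma α).prod (stdGaussian (EuclideanSpace ℝ (Fin d)))).map
    (fun z => Real.sqrt (γ / 2 * z.1) • z.2)

/-- The law on `ℝ` of a sign which is `+1` with probability `p` and `-1` with probability `q`. -/
def signLaw (p q : ℝ≥0) : Measure ℝ :=
  p • Measure.dirac (1 : ℝ) + q • Measure.dirac (-1 : ℝ)

/-- `N` is a Poisson process with the given rate: it starts at `0`, its paths are non-decreasing
and right-continuous, and its increments are independent with Poisson laws. -/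
structure IsPoissonProcess {Ω : Type*} [MeasurableSpace Ω] (rate : ℝ≥0)
    (N : ℝ≥0 → Ω → ℕ) (P : Measure Ω) : Prop where
  measurable : ∀ t, Measurable (N t)
  zero : ∀ᵐ ω ∂P, N 0 ω = 0
  mono : ∀ᵐ ω ∂P, Monotone (fun t => N t ω)
  right_continuous : ∀ᵐ ω ∂P, ∀ t, ContinuousWithinAt (fun s => N s ω) (Set.Ici t) t
  indep_increments : HasIndepIncrements N P
  increments : ∀ s h, HasLaw (fun ω => N (s + h) ω - N s ω) (poissonMeasure (rate * h)) P

/-- `N` is a Poisson process, the `Y j` are i.i.d. with the law `jumpLaw d α γ`, the `ε j` are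
i.i.d. signs, and all these objects are independent. -/
structure IsRandomWalkInput {Ω : Type*} [MeasurableSpace Ω] (d : ℕ) (α : ℝ) (rate p q γ : ℝ≥0)
    (N : ℝ≥0 → Ω → ℕ) (ε : ℕ → Ω → ℝ) (Y : ℕ → Ω → EuclideanSpace ℝ (Fin d))
    (P : Measure Ω) : Prop where
  poisson : IsPoissonProcess rate N P
  measurable_sign : ∀ j, Measurable (ε j)
  measurable_jump : ∀ j, Measurable (Y j)
  law_sign : ∀ j, HasLaw (ε j) (signLaw p q) P
  law_jump : ∀ j, HasLaw (Y j) (jumpLaw d α γ) P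
  /-- The sign `ε j` and the vector `Y j` are independent. -/
  indep_sign_jump : ∀ j, IndepFun (ε j) (Y j) P
  /-- The pairs `(ε j, Y j)` are independent. -/
  indep_pairs : iIndepFun (fun j ω => (ε j ω, Y j ω)) P
  /-- The process `N` is independent of the sequence of all the pairs. -/
  indep_poisson : IndepFun (fun ω t => N t ω) (fun ω j => (ε j ω, Y j ω)) P

/-- The random walk `A(t) = ∑_{j=0}^{N(t)} ε_j Y_j`. -/
def randomWalk {Ω : Type*} {d : ℕ} (N : ℝ≥0 → Ω → ℕ) (ε : ℕ → Ω → ℝ)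
    (Y : ℕ → Ω → EuclideanSpace ℝ (Fin d)) (t : ℝ≥0) (ω : Ω) : EuclideanSpace ℝ (Fin d) :=
  ∑ j ∈ Finset.range (N t ω + 1), ε j ω • Y j ω

/-- `S` is an isotropic `β`-stable process in `ℝ^d`: a Lévy process (started at `0`, stationary
independent increments, continuous in probability) with characteristic function
`E exp (i ξ · S(t)) = exp (-t |ξ| ^ β)`. -/
structure IsIsotropicStable {Ω : Type*} [MeasurableSpace Ω] {d : ℕ} (β : ℝ)
    (S : ℝ≥0 → Ω → EuclideanSpace ℝ (Fin d)) (P : Measure Ω) : Prop where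
  measurable : ∀ t, Measurable (S t)
  zero : ∀ᵐ ω ∂P, S 0 ω = 0
  indep_increments : HasIndepIncrements S P
  stationary_increments : ∀ s h, IdentDistrib (fun ω => S (s + h) ω - S s ω) (S h) P P
  continuous_in_probability : ∀ t, TendstoInMeasure P S (𝓝 t) (S t)
  charFun_eq : ∀ t ξ, charFun (P.map (S t)) ξ = Complex.exp (-((t * ‖ξ‖ ^ β : ℝ) : ℂ))

/-- The integrand `(1 - cos y₁) / |y| ^ (2α + d)`. -/
def stableIntegrand (d : ℕ) [NeZero d] (α : ℝ) (y : EuclideanSpace ℝ (Fin d)) : ℝ :=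
  (1 - Real.cos (y 0)) / ‖y‖ ^ (2 * α + d)

/-- The constant `C = ∫ (1 - cos y₁) / |y| ^ (2α + d) dy`. -/
def stableConst (d : ℕ) [NeZero d] (α : ℝ) : ℝ :=
  ∫ y : EuclideanSpace ℝ (Fin d), stableIntegrand d α y

/-- The constant `Γ(α + d/2) / (π ^ (d/2) Γ(α))`. -/
def gammaRatio (d : ℕ) (α : ℝ) : ℝ :=
  Real.Gamma (α + d / 2) / (Real.pi ^ ((d : ℝ) / 2) * Real.Gamma α)

lemma stableConst_nonneg (d : ℕ) [NeZero d] (α : ℝ) : 0 ≤ stableConst d α :=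
  integral_nonneg fun y => by
    show 0 ≤ (1 - Real.cos (y 0)) / ‖y‖ ^ (2 * α + d)
    exact div_nonneg (sub_nonneg.2 (Real.cos_le_one _)) (by positivity)

/-- The time change `t* = rate * Γ(α + d/2) / (π ^ (d/2) Γ(α)) * C * t`. For `α > 0` the constant
is non-negative, so that `Real.toNNReal` only changes its type. -/
def starTime (d : ℕ) [NeZero d] (α : ℝ) (rate t : ℝ≥0) : ℝ≥0 :=
  Real.toNNReal (rate * gammaRatio d α * stableConst d α) * t

lemma coe_starTime (d : ℕ) [NeZero d] {α : ℝ} (hα : 0 < α) (rate t : ℝ≥0) :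
    (starTime d α rate t : ℝ) = rate * gammaRatio d α * stableConst d α * t := by
  have h1 : 0 < Real.Gamma (α + d / 2) := Real.Gamma_pos_of_pos (by positivity)
  have h2 : 0 < Real.Gamma α := Real.Gamma_pos_of_pos hα
  have h3 := stableConst_nonneg d α
  have h4 : 0 ≤ gammaRatio d α := by unfold gammaRatio; positivity
  rw [starTime, NNReal.coe_mul, Real.coe_toNNReal _ (by positivity)]

/-- The fractional Laplacian `(-Δ)^α` on Schwartz functions: the Fourier multiplier `|ξ| ^ (2α)`.
With the Fourier kernel `exp (-2 π i ξ · x)` used here, the multiplier is `(2 π |ξ|) ^ (2α)`. -/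
def fracLaplacian {d : ℕ} (α : ℝ) (f : 𝓢(EuclideanSpace ℝ (Fin d), ℂ)) :
    EuclideanSpace ℝ (Fin d) → ℂ :=
  𝓕⁻ (fun ξ : EuclideanSpace ℝ (Fin d) =>
    (((2 * Real.pi * ‖ξ‖) ^ (2 * α) : ℝ) : ℂ) * 𝓕 (f : EuclideanSpace ℝ (Fin d) → ℂ) ξ)

/-- The transition semigroup `T_t f(x) = E f(x + X(t))` of a Lévy process `X`. -/
def transitionOp {Ω : Type*} [MeasurableSpace Ω] {d : ℕ}
    (X : ℝ≥0 → Ω → EuclideanSpace ℝ (Fin d)) (P : Measure Ω) (t : ℝ≥0)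
    (f : EuclideanSpace ℝ (Fin d) → ℂ) (x : EuclideanSpace ℝ (Fin d)) : ℂ :=
  ∫ ω, f (x + X t ω) ∂P

/-- `f` lies in the domain of the (Feller) infinitesimal generator `𝒜` of `X`, and `𝒜 f = g`:
the quotients `(T_h f - f) / h` converge to `g` in the supremum norm as `h ↓ 0`. -/
def GeneratorMapsTo {Ω : Type*} [MeasurableSpace Ω] {d : ℕ}
    (X : ℝ≥0 → Ω → EuclideanSpace ℝ (Fin d)) (P : Measure Ω)
    (f g : EuclideanSpace ℝ (Fin d) → ℂ) : Prop :=
  TendstoUniformly (fun (h : ℝ≥0) x => (transitionOp X P h f x - f x) / ((h : ℝ) : ℂ)) g (𝓝[>] 0)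

end

/-!
Everything is read off from characteristic functions.

Mixing the centred normal densities of variance `γ x / 2` over the reciprocal gamma law in `x` gives
a gamma integral in `1 / x`, whence the density of a jump (`jumpLaw_eq_withDensity`). This density
is even, so the random signs leave the law of a jump unchanged, and its characteristic function is
`1 - ψ_γ(ξ)` with `ψ_γ(ξ) = ∫ (1 - cos (ξ · y)) ν_γ(y) dy`, called `jumpExponent` below. As `γ ↓ 0`,
`ν_γ / γ ^ α` increases to a multiple of `|y| ^ (-2α - d)`, against which `1 - cos (ξ · y)` is
integrable. By dominated convergence, rotation and scaling, `ψ_γ(ξ) / γ ^ α` tends to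
`gammaRatio d α * C * |ξ| ^ (2α)` (`tendsto_jumpExponent_div`).

For `0 = τ₀ ≤ τ₁ ≤ … ≤ τₖ`, conditioning on the Poisson process shows that the increments of the
walk are independent with characteristic functions `exp (-rate (τₘ₊₁ - τₘ) ψ_γ)`, apart from the
initial jump `ε₀ Y₀`, which contributes the factor `1 - ψ_γ → 1`
(`integral_exp_incrementVec_randomWalk`). At the times `τₘ / γ ^ α` these functions converge to
those of the increments of the stable process. Lévy's convergence theorem gives joint convergence
of the increments, and the values of the process at arbitrary times are partial sums of them
(`tendstoInDistribution_randomWalk`).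

For the generator, Fourier inversion makes the transition operators into Fourier multipliers with
symbol `exp (-h c |ξ| ^ (2α))`. The estimate `|exp (-u) - 1 + u| ≤ u² / 2` for `u ≥ 0` bounds
the difference between the quotient and the multiplier operator by a multiple of `h`, uniformly in
`x`, because `|ξ| ^ (4α)` is integrable against the Fourier transform of a Schwartz function
(`generatorMapsTo_of_charFun`).
-/

/-! ### The law of a jump -/

/-- A reciprocal gamma integral: the substitution `t = x⁻¹` in the gamma integral. -/
lemma lintegral_rpow_mul_exp_neg_div_Ioi {a r : ℝ} (ha : 0 < a) (hr : 0 < r) :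
    ∫⁻ x in Set.Ioi (0 : ℝ), ENNReal.ofReal (x ^ (-a - 1) * Real.exp (-(r / x))) =
      ENNReal.ofReal ((1 / r) ^ a * Real.Gamma a) := by
  have key : ∫ x in Set.Ioi (0 : ℝ), x ^ (-a - 1) * Real.exp (-(r / x)) =
      (1 / r) ^ a * Real.Gamma a := by
    rw [← Real.integral_rpow_mul_exp_neg_mul_Ioi ha hr,
      ← integral_comp_rpow_Ioi (fun t : ℝ => t ^ (a - 1) * Real.exp (-(r * t)))
        (show (-1 : ℝ) ≠ 0 by norm_num)]
    refine setIntegral_congr_fun measurableSet_Ioi fun x hx => ?_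
    have hx : 0 < x := hx
    simp only [smul_eq_mul, abs_neg, abs_one, one_mul]
    rw [← Real.rpow_mul hx.le, ← mul_assoc, ← Real.rpow_add hx, Real.rpow_neg_one,
      div_eq_mul_inv]
    congr 2
    ring
  have hpos : 0 < (1 / r) ^ a * Real.Gamma a :=
    mul_pos (by positivity) (Real.Gamma_pos_of_pos ha)
  rw [← key, ofReal_integral_eq_lintegral_ofReal]
  · exact not_imp_comm.1 integral_undef (key ▸ hpos.ne')
  · filter_upwards [ae_restrict_mem measurableSet_Ioi] with x hx
    have hx : 0 < x := hx
    show 0 ≤ _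
    positivity

/-- The density of the centred normal law on `ℝ ^ d` with covariance `v I`. -/
noncomputable def centredNormalDensity (d : ℕ) (v : ℝ) (y : EuclideanSpace ℝ (Fin d)) : ℝ :=
  (2 * Real.pi * v) ^ (-((d : ℝ) / 2)) * Real.exp (-(‖y‖ ^ 2 / (2 * v)))

lemma measurable_centredNormalDensity (d : ℕ) :
    Measurable fun z : ℝ × EuclideanSpace ℝ (Fin d) => centredNormalDensity d z.1 z.2 := by
  unfold centredNormalDensity
  fun_prop

/-- The law of `√v G`, with `G` standard normal, is identified by its characteristic function. -/
lemma map_sqrt_smul_stdGaussian (d : ℕ) {v : ℝ} (hv : 0 < v) :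
    (stdGaussian (EuclideanSpace ℝ (Fin d))).map (fun y => Real.sqrt v • y) =
      volume.withDensity (fun y => ENNReal.ofReal (centredNormalDensity d v y)) := by
  have hmeas : Measurable (centredNormalDensity d v) :=
    (measurable_centredNormalDensity d).comp measurable_prodMk_left
  have hnn : ∀ y, 0 ≤ centredNormalDensity d v y := fun y => by
    unfold centredNormalDensity; positivity
  have hb : 0 < (1 / (2 * v) : ℝ) := by positivity
  have hb' : 0 < (((1 / (2 * v) : ℝ) : ℂ)).re := by simpa using hb
  have hint : Integrable (centredNormalDensity d v) := by
    have h := (GaussianFourier.integrable_cexp_neg_mul_sq_norm_add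
      (V := EuclideanSpace ℝ (Fin d)) hb' 0 0).re
    refine (h.const_mul ((2 * Real.pi * v) ^ (-((d : ℝ) / 2)))).congr (ae_of_all _ fun y => ?_)
    simp only [centredNormalDensity, zero_mul, add_zero]
    congr 1
    have : -(((1 / (2 * v) : ℝ) : ℂ)) * (‖y‖ : ℂ) ^ 2 = ((-(‖y‖ ^ 2 / (2 * v)) : ℝ) : ℂ) := by
      push_cast; ring
    rw [this, ← Complex.ofReal_exp]
    rfl
  have : IsFiniteMeasure (volume.withDensity
      (fun y => ENNReal.ofReal (centredNormalDensity d v y))) :=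
    isFiniteMeasure_withDensity_ofReal hint.2
  have : IsProbabilityMeasure ((stdGaussian (EuclideanSpace ℝ (Fin d))).map
      (fun y => Real.sqrt v • y)) := Measure.isProbabilityMeasure_map (by fun_prop)
  refine Measure.ext_of_charFun (funext fun t => ?_)
  rw [charFun_map_smul, charFun_stdGaussian, charFun_apply,
    integral_withDensity_eq_integral_toReal_smul (by fun_prop) (by simp)]
  have h : ∀ y : EuclideanSpace ℝ (Fin d),
      (ENNReal.ofReal (centredNormalDensity d v y)).toReal •
        Complex.exp ((inner ℝ y t : ℝ) * Complex.I) =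
      (((2 * Real.pi * v) ^ (-((d : ℝ) / 2)) : ℝ) : ℂ) *
        Complex.exp (-(((1 / (2 * v) : ℝ) : ℂ)) * (‖y‖ : ℂ) ^ 2 +
          Complex.I * (inner ℝ t y : ℝ)) := fun y => by
    rw [ENNReal.toReal_ofReal (hnn y), centredNormalDensity, Complex.exp_add, real_inner_comm]
    have : -(((1 / (2 * v) : ℝ) : ℂ)) * (‖y‖ : ℂ) ^ 2 = ((-(‖y‖ ^ 2 / (2 * v)) : ℝ) : ℂ) := by
      push_cast; ring
    rw [this, ← Complex.ofReal_exp, Complex.real_smul, mul_comm Complex.I]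
    push_cast; ring
  simp_rw [h]
  rw [integral_const_mul, GaussianFourier.integral_cexp_neg_mul_sq_norm_add hb']
  have hc : (((2 * Real.pi * v) ^ (-((d : ℝ) / 2)) : ℝ) : ℂ) *
      ((Real.pi : ℂ) / ((1 / (2 * v) : ℝ) : ℂ)) ^
        ((Module.finrank ℝ (EuclideanSpace ℝ (Fin d)) : ℂ) / 2) = 1 := by
    have e : (Real.pi : ℂ) / ((1 / (2 * v) : ℝ) : ℂ) = ((2 * Real.pi * v : ℝ) : ℂ) := by
      have : (v : ℂ) ≠ 0 := by exact_mod_cast hv.ne'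
      push_cast; field_simp
    have e2 : ((Module.finrank ℝ (EuclideanSpace ℝ (Fin d)) : ℂ) / 2) =
        (((d : ℝ) / 2 : ℝ) : ℂ) := by simp
    rw [e, e2, ← Complex.ofReal_cpow (by positivity), ← Complex.ofReal_mul,
      ← Real.rpow_add (by positivity)]
    simp
  rw [← mul_assoc, hc, one_mul, norm_smul, Real.norm_of_nonneg (Real.sqrt_nonneg v)]
  congr 1
  have h1 : ((Real.sqrt v : ℝ) : ℂ) ^ 2 = v := by
    rw [← Complex.ofReal_pow, Real.sq_sqrt hv.le]
  have : (v : ℂ) ≠ 0 := by exact_mod_cast hv.ne'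
  push_cast
  rw [mul_pow, h1, Complex.I_sq]
  field_simp
  norm_num

/-- The density of a jump is obtained by integrating the normal densities with variance `γ x / 2`
against the reciprocal gamma law in the variable `x`. -/
theorem jumpLaw_eq_withDensity (d : ℕ) {α : ℝ} (hα : 0 < α) {γ : ℝ≥0} (hγ : 0 < γ) :
    jumpLaw d α γ = volume.withDensity (fun y => ENNReal.ofReal
        (gammaRatio d α * ((γ : ℝ) ^ α / (‖y‖ ^ 2 + γ) ^ (α + (d : ℝ) / 2)))) := by
  have hγ' : (0 : ℝ) < γ := by exact_mod_cast hγ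
  set w : ℝ → ℝ := fun x => x ^ (-α - 1) / Real.Gamma α * Real.exp (-1 / x) with hw
  have hwm : Measurable w := by fun_prop
  have hΓ : 0 < Real.Gamma α := Real.Gamma_pos_of_pos hα
  have hfm : Measurable fun z : ℝ × EuclideanSpace ℝ (Fin d) => Real.sqrt (γ / 2 * z.1) • z.2 := by
    fun_prop
  have hg : Measurable fun z : ℝ × EuclideanSpace ℝ (Fin d) =>
      centredNormalDensity d (γ / 2 * z.1) z.2 :=
    (measurable_centredNormalDensity d).comp
      (((measurable_const.mul measurable_fst)).prodMk measurable_snd)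
  have hsf : SFinite (reciprocalGamma α) := by unfold reciprocalGamma; infer_instance
  ext A hA
  rw [jumpLaw, Measure.map_apply hfm hA, Measure.prod_apply (hfm hA), withDensity_apply _ hA]
  have hslice : ∀ x : ℝ, 0 < x →
      stdGaussian (EuclideanSpace ℝ (Fin d)) (Prod.mk x ⁻¹'
        ((fun z : ℝ × EuclideanSpace ℝ (Fin d) => Real.sqrt (γ / 2 * z.1) • z.2) ⁻¹' A)) =
      ∫⁻ y in A, ENNReal.ofReal (centredNormalDensity d (γ / 2 * x) y) := fun x hx => by
    rw [← withDensity_apply _ hA, ← map_sqrt_smul_stdGaussian d (show 0 < γ / 2 * x by positivity),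
      Measure.map_apply (by fun_prop) hA]
    rfl
  rw [reciprocalGamma, lintegral_withDensity_eq_lintegral_mul _
    (show Measurable fun x => ENNReal.ofReal (w x) by fun_prop)
    (measurable_measure_prodMk_left (hfm hA))]
  rw [setLIntegral_congr_fun (g := fun x => ∫⁻ y in A, ENNReal.ofReal (w x) *
    ENNReal.ofReal (centredNormalDensity d (γ / 2 * x) y)) measurableSet_Ioi]
  swap
  · intro x hx
    simp only [Pi.mul_apply]
    rw [hslice x hx, lintegral_const_mul]
    exact (hg.comp measurable_prodMk_left).ennreal_ofReal
  rw [lintegral_lintegral_swap]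
  swap
  · exact ((hwm.comp measurable_fst).ennreal_ofReal.mul hg.ennreal_ofReal).aemeasurable
  refine setLIntegral_congr_fun hA fun y _ => ?_
  have hc : 0 ≤ (Real.pi * γ) ^ (-((d : ℝ) / 2)) / Real.Gamma α := by positivity
  have ha : 0 < α + (d : ℝ) / 2 := by positivity
  have hr : 0 < 1 + ‖y‖ ^ 2 / γ := by positivity
  rw [setLIntegral_congr_fun (g := fun x =>
    ENNReal.ofReal ((Real.pi * γ) ^ (-((d : ℝ) / 2)) / Real.Gamma α) *
    ENNReal.ofReal (x ^ (-(α + (d : ℝ) / 2) - 1) * Real.exp (-((1 + ‖y‖ ^ 2 / γ) / x))))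
    measurableSet_Ioi]
  swap
  · intro x hx
    have hx : 0 < x := hx
    have hwx : 0 ≤ w x := by simp only [hw]; positivity
    simp only
    rw [← ENNReal.ofReal_mul hwx, ← ENNReal.ofReal_mul hc]
    congr 1
    simp only [hw, centredNormalDensity]
    rw [show 2 * Real.pi * (γ / 2 * x) = Real.pi * γ * x by ring,
      Real.mul_rpow (by positivity) hx.le,
      show -(α + (d : ℝ) / 2) - 1 = (-α - 1) + (-((d : ℝ) / 2)) by ring, Real.rpow_add hx,
      show -((1 + ‖y‖ ^ 2 / γ) / x) = -1 / x + -(‖y‖ ^ 2 / (2 * (γ / 2 * x))) by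
        field_simp; ring, Real.exp_add]
    ring
  rw [lintegral_const_mul _ (by fun_prop), lintegral_rpow_mul_exp_neg_div_Ioi ha hr,
    ← ENNReal.ofReal_mul hc]
  congr 1
  rw [gammaRatio, Real.mul_rpow Real.pi_pos.le hγ'.le, Real.rpow_neg Real.pi_pos.le,
    show 1 / (1 + ‖y‖ ^ 2 / γ) = γ / (‖y‖ ^ 2 + γ) by field_simp; ring,
    Real.div_rpow hγ'.le (by positivity), Real.rpow_neg hγ'.le, Real.rpow_add hγ']
  have : (γ : ℝ) ^ ((d : ℝ) / 2) ≠ 0 := by positivity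
  field_simp

/-! ### The jump measure of the stable process -/

lemma one_sub_cos_le_two (x : ℝ) : 1 - Real.cos x ≤ 2 := by
  linarith [Real.neg_one_le_cos x]

lemma one_sub_cos_le_sq_div_two (x : ℝ) : 1 - Real.cos x ≤ x ^ 2 / 2 := by
  linarith [Real.one_sub_sq_div_two_le_cos (x := x)]

/-- Polar coordinates reduce the integrability of `min (c |y|²) 2 / |y| ^ (2α + d)` to that of
`r ^ (1 - 2α)` near `0` and of `r ^ (-1 - 2α)` near `∞`. -/
lemma integrable_min_sq_div_norm_rpow (d : ℕ) [NeZero d] {α : ℝ} (hα0 : 0 < α) (hα1 : α < 1)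
    {c : ℝ} (hc : 0 ≤ c) :
    Integrable fun y : EuclideanSpace ℝ (Fin d) =>
      min (c * ‖y‖ ^ 2) 2 / ‖y‖ ^ (2 * α + d) := by
  have hd : 1 ≤ d := NeZero.one_le
  have : Nontrivial (EuclideanSpace ℝ (Fin d)) := by
    have : Nonempty (Fin d) := ⟨0⟩
    infer_instance
  rw [integrable_fun_norm_addHaar (volume : Measure (EuclideanSpace ℝ (Fin d)))
    (f := fun r => min (c * r ^ 2) 2 / r ^ (2 * α + d))]
  rw [finrank_euclideanSpace_fin, ← Set.Ioc_union_Ioi_eq_Ioi zero_le_one]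
  have hmeas : Measurable fun r : ℝ => r ^ (d - 1) • (min (c * r ^ 2) 2 / r ^ (2 * α + d)) := by
    fun_prop
  have hpow : ∀ r : ℝ, 0 < r → ∀ b : ℝ, r ^ (d - 1) • (b / r ^ (2 * α + d)) =
      b * r ^ (-1 - 2 * α) := fun r hr b => by
    rw [smul_eq_mul, ← Real.rpow_natCast, Nat.cast_sub hd,
      show -1 - 2 * α = ((d : ℝ) - (1 : ℕ)) - (2 * α + d) by push_cast; ring,
      Real.rpow_sub hr _ (2 * α + d)]
    ring
  refine IntegrableOn.union ?_ ?_
  · have hbase : IntegrableOn (fun r : ℝ => c * r ^ (1 - 2 * α)) (Set.Ioc 0 1) := by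
      refine Integrable.const_mul ?_ c
      exact (intervalIntegral.intervalIntegrable_rpow' (a := 0) (b := 1)
        (show -1 < 1 - 2 * α by linarith)).1
    refine Integrable.mono' hbase hmeas.aestronglyMeasurable ?_
    filter_upwards [ae_restrict_mem measurableSet_Ioc] with r hr
    rw [hpow r hr.1, Real.norm_of_nonneg
      (mul_nonneg (le_min (by positivity) zero_le_two) (Real.rpow_nonneg hr.1.le _)),
      show 1 - 2 * α = 2 + (-1 - 2 * α) by ring, Real.rpow_add hr.1, Real.rpow_two, ← mul_assoc]
    exact mul_le_mul_of_nonneg_right (min_le_left _ _) (Real.rpow_nonneg hr.1.le _)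
  · have hbase : IntegrableOn (fun r : ℝ => 2 * r ^ (-1 - 2 * α)) (Set.Ioi 1) :=
      (integrableOn_Ioi_rpow_of_lt (by linarith) zero_lt_one).const_mul 2
    refine Integrable.mono' hbase hmeas.aestronglyMeasurable ?_
    filter_upwards [ae_restrict_mem measurableSet_Ioi] with r hr
    have hr0 : (0 : ℝ) < r := zero_lt_one.trans hr
    rw [hpow r hr0, Real.norm_of_nonneg
      (mul_nonneg (le_min (by positivity) zero_le_two) (Real.rpow_nonneg hr0.le _))]
    exact mul_le_mul_of_nonneg_right (min_le_right _ _) (Real.rpow_nonneg hr0.le _)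

lemma integrable_one_sub_cos_inner_div (d : ℕ) [NeZero d] {α : ℝ} (hα0 : 0 < α) (hα1 : α < 1)
    (ξ : EuclideanSpace ℝ (Fin d)) :
    Integrable fun y : EuclideanSpace ℝ (Fin d) =>
      (1 - Real.cos (inner ℝ ξ y)) / ‖y‖ ^ (2 * α + d) := by
  have hmeas : Measurable fun y : EuclideanSpace ℝ (Fin d) =>
      (1 - Real.cos (inner ℝ ξ y)) / ‖y‖ ^ (2 * α + d) := by fun_prop
  refine (integrable_min_sq_div_norm_rpow d hα0 hα1
    (show 0 ≤ ‖ξ‖ ^ 2 / 2 by positivity)).mono' hmeas.aestronglyMeasurable (ae_of_all _ fun y => ?_)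
  rw [Real.norm_of_nonneg (div_nonneg (sub_nonneg.2 (Real.cos_le_one _)) (by positivity))]
  refine div_le_div_of_nonneg_right (le_min ?_ (one_sub_cos_le_two _)) (by positivity)
  refine (one_sub_cos_le_sq_div_two _).trans ?_
  have h : |inner ℝ ξ y| ^ 2 ≤ (‖ξ‖ * ‖y‖) ^ 2 :=
    pow_le_pow_left₀ (abs_nonneg _) (abs_real_inner_le_norm ξ y) 2
  rw [sq_abs] at h
  nlinarith

lemma inner_single_zero_left {d : ℕ} [NeZero d] (y : EuclideanSpace ℝ (Fin d)) :
    inner ℝ (EuclideanSpace.single (0 : Fin d) (1 : ℝ)) y = y 0 := by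
  simp [EuclideanSpace.inner_single_left]

theorem integrable_stableIntegrand (d : ℕ) [NeZero d] {α : ℝ} (hα0 : 0 < α) (hα1 : α < 1) :
    Integrable (stableIntegrand d α) := by
  unfold stableIntegrand
  simpa only [inner_single_zero_left] using
    integrable_one_sub_cos_inner_div d hα0 hα1 (EuclideanSpace.single (0 : Fin d) (1 : ℝ))

/-- Rotating `ξ` onto the first coordinate axis by a reflection, and rescaling by `‖ξ‖`. -/
theorem integral_one_sub_cos_inner_div (d : ℕ) [NeZero d] {α : ℝ} (hα0 : 0 < α)
    (ξ : EuclideanSpace ℝ (Fin d)) :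
    ∫ y : EuclideanSpace ℝ (Fin d), (1 - Real.cos (inner ℝ ξ y)) / ‖y‖ ^ (2 * α + d) =
      ‖ξ‖ ^ (2 * α) * stableConst d α := by
  rcases eq_or_ne ξ 0 with rfl | hξ
  · simp [Real.zero_rpow (show 2 * α ≠ 0 by positivity)]
  have hξ' : 0 < ‖ξ‖ := norm_pos_iff.2 hξ
  set e : EuclideanSpace ℝ (Fin d) := ‖ξ‖ • EuclideanSpace.single (0 : Fin d) (1 : ℝ) with he
  have hnorm : ‖e‖ = ‖ξ‖ := by simp [he, norm_smul]
  set R := Submodule.reflection (Submodule.span ℝ {e - ξ})ᗮ with hR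
  have hRe : R e = ξ := Submodule.reflection_sub hnorm
  rw [← R.measurePreserving.integral_comp R.toHomeomorph.measurableEmbedding]
  have h : ∀ z : EuclideanSpace ℝ (Fin d),
      (1 - Real.cos (inner ℝ ξ (R z))) / ‖R z‖ ^ (2 * α + d) =
      ‖ξ‖ ^ (2 * α + d) * stableIntegrand d α (‖ξ‖ • z) := fun z => by
    rw [← hRe, LinearIsometryEquiv.inner_map_map, hRe, LinearIsometryEquiv.norm_map, he,
      real_inner_smul_left, inner_single_zero_left, stableIntegrand, norm_smul, norm_norm,
      Real.mul_rpow hξ'.le (norm_nonneg z)]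
    have : ‖ξ‖ ^ (2 * α + d) ≠ 0 := by positivity
    simp only [PiLp.smul_apply, smul_eq_mul]
    field_simp
  simp_rw [h]
  rw [integral_const_mul, Measure.integral_comp_smul, finrank_euclideanSpace_fin,
    abs_of_nonneg (by positivity), smul_eq_mul, ← mul_assoc, Real.rpow_add hξ',
    Real.rpow_natCast, mul_assoc (‖ξ‖ ^ (2 * α)), mul_inv_cancel₀ (by positivity), mul_one]
  rfl

/-! ### The characteristic function of a jump -/

lemma isProbabilityMeasure_reciprocalGamma {α : ℝ} (hα : 0 < α) :
    IsProbabilityMeasure (reciprocalGamma α) := by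
  have hΓ : 0 < Real.Gamma α := Real.Gamma_pos_of_pos hα
  refine ⟨?_⟩
  rw [reciprocalGamma, withDensity_apply _ MeasurableSet.univ, Measure.restrict_univ,
    lintegral_congr (g := fun x => ENNReal.ofReal (Real.Gamma α)⁻¹ *
      ENNReal.ofReal (x ^ (-α - 1) * Real.exp (-(1 / x)))) fun x => ?_,
    lintegral_const_mul _ (by fun_prop), lintegral_rpow_mul_exp_neg_div_Ioi hα zero_lt_one,
    ← ENNReal.ofReal_mul (by positivity)]
  · simp [hΓ.ne']
  · rw [← ENNReal.ofReal_mul (by positivity), neg_div]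
    congr 1
    ring

lemma isProbabilityMeasure_jumpLaw (d : ℕ) {α : ℝ} (hα : 0 < α) (γ : ℝ≥0) :
    IsProbabilityMeasure (jumpLaw d α γ) := by
  have := isProbabilityMeasure_reciprocalGamma hα
  exact Measure.isProbabilityMeasure_map
    (show Measurable fun z : ℝ × EuclideanSpace ℝ (Fin d) =>
      Real.sqrt (γ / 2 * z.1) • z.2 by fun_prop).aemeasurable

/-- The defect `1 - E cos (ξ · Y)` of the characteristic function of a jump. -/
noncomputable def jumpExponent (d : ℕ) (α γ : ℝ) (ξ : EuclideanSpace ℝ (Fin d)) : ℝ :=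
  ∫ y : EuclideanSpace ℝ (Fin d), gammaRatio d α * (γ ^ α / (‖y‖ ^ 2 + γ) ^ (α + (d : ℝ) / 2)) *
    (1 - Real.cos (inner ℝ ξ y))

lemma gammaRatio_nonneg (d : ℕ) {α : ℝ} (hα : 0 < α) : 0 ≤ gammaRatio d α := by
  have h1 : 0 < Real.Gamma (α + d / 2) := Real.Gamma_pos_of_pos (by positivity)
  have h2 : 0 < Real.Gamma α := Real.Gamma_pos_of_pos hα
  unfold gammaRatio
  positivity

lemma integral_jumpLaw {F : Type*} [NormedAddCommGroup F] [NormedSpace ℝ F] (d : ℕ) {α : ℝ}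
    (hα : 0 < α) {γ : ℝ≥0} (hγ : 0 < γ) (f : EuclideanSpace ℝ (Fin d) → F) :
    ∫ y, f y ∂(jumpLaw d α γ) = ∫ y, (gammaRatio d α *
      ((γ : ℝ) ^ α / (‖y‖ ^ 2 + γ) ^ (α + (d : ℝ) / 2))) • f y := by
  have h1 := gammaRatio_nonneg d hα
  rw [jumpLaw_eq_withDensity d hα hγ,
    integral_withDensity_eq_integral_toReal_smul (by fun_prop) (by simp)]
  refine integral_congr_ae (ae_of_all _ fun y => ?_)
  simp only
  rw [ENNReal.toReal_ofReal (by positivity)]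

theorem charFun_jumpLaw (d : ℕ) {α : ℝ} (hα : 0 < α) {γ : ℝ≥0} (hγ : 0 < γ)
    (ξ : EuclideanSpace ℝ (Fin d)) :
    charFun (jumpLaw d α γ) ξ = ((1 - jumpExponent d α γ ξ : ℝ) : ℂ) := by
  have := isProbabilityMeasure_jumpLaw d hα γ
  -- the law is symmetric, so that its characteristic function is real
  have hsymm : charFun (jumpLaw d α γ) (-ξ) = charFun (jumpLaw d α γ) ξ := by
    rw [charFun_apply, charFun_apply, integral_jumpLaw d hα hγ, integral_jumpLaw d hα hγ,
      ← integral_neg_eq_self]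
    simp
  have hint : Integrable (fun y : EuclideanSpace ℝ (Fin d) =>
      Complex.exp ((inner ℝ y ξ : ℝ) * Complex.I)) (jumpLaw d α γ) := by
    refine (integrable_const (1 : ℝ)).mono' (by fun_prop) (ae_of_all _ fun y => ?_)
    rw [Complex.norm_exp_ofReal_mul_I]
  have hre : (charFun (jumpLaw d α γ) ξ).re =
      ∫ y, Real.cos (inner ℝ ξ y) ∂(jumpLaw d α γ) := by
    rw [charFun_apply]
    refine (integral_re hint).symm.trans ?_
    refine integral_congr_ae (ae_of_all _ fun y => ?_)
    simp [Complex.exp_ofReal_mul_I_re, real_inner_comm]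
  rw [charFun_neg] at hsymm
  rw [← Complex.conj_eq_iff_re.1 hsymm, hre]
  congr 1
  have hcos : Integrable (fun y : EuclideanSpace ℝ (Fin d) => Real.cos (inner ℝ ξ y))
      (jumpLaw d α γ) := by
    refine (integrable_const (1 : ℝ)).mono' (by fun_prop) (ae_of_all _ fun y => ?_)
    exact Real.abs_cos_le_one _
  have h : jumpExponent d α γ ξ =
      ∫ y, (1 - Real.cos (inner ℝ ξ y)) ∂(jumpLaw d α γ) := by
    rw [integral_jumpLaw d hα hγ]
    rfl
  rw [h, integral_sub (integrable_const _) hcos]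
  simp

/-- After division by `γ ^ α` the jump densities increase, as `γ` decreases to `0`, to the jump
density of the stable process, and the convergence of the integrals is dominated. -/
theorem tendsto_jumpExponent_div (d : ℕ) [NeZero d] {α : ℝ} (hα0 : 0 < α) (hα1 : α < 1)
    (ξ : EuclideanSpace ℝ (Fin d)) :
    Tendsto (fun γ : ℝ => jumpExponent d α γ ξ / γ ^ α) (𝓝[>] 0)
      (𝓝 (gammaRatio d α * stableConst d α * ‖ξ‖ ^ (2 * α))) := by
  have hs : 0 < α + (d : ℝ) / 2 := by positivity
  have hnn : ∀ y : EuclideanSpace ℝ (Fin d), 0 ≤ 1 - Real.cos (inner ℝ ξ y) := fun y =>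
    sub_nonneg.2 (Real.cos_le_one _)
  have hpow : ∀ y : EuclideanSpace ℝ (Fin d),
      (‖y‖ ^ 2) ^ (α + (d : ℝ) / 2) = ‖y‖ ^ (2 * α + d) := fun y => by
    rw [← Real.rpow_natCast, ← Real.rpow_mul (norm_nonneg y)]
    congr 1
    push_cast
    ring
  have hmeas : ∀ γ : ℝ, Measurable fun y : EuclideanSpace ℝ (Fin d) =>
      (1 - Real.cos (inner ℝ ξ y)) / (‖y‖ ^ 2 + γ) ^ (α + (d : ℝ) / 2) := fun γ => by fun_prop
  have hlim : Tendsto (fun γ : ℝ => ∫ y : EuclideanSpace ℝ (Fin d),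
      (1 - Real.cos (inner ℝ ξ y)) / (‖y‖ ^ 2 + γ) ^ (α + (d : ℝ) / 2)) (𝓝[>] 0)
      (𝓝 (∫ y : EuclideanSpace ℝ (Fin d),
        (1 - Real.cos (inner ℝ ξ y)) / ‖y‖ ^ (2 * α + d))) := by
    refine tendsto_integral_filter_of_dominated_convergence _
      (Eventually.of_forall fun γ => (hmeas γ).aestronglyMeasurable) ?_
      (integrable_one_sub_cos_inner_div d hα0 hα1 ξ) (ae_of_all _ fun y => ?_)
    · filter_upwards [self_mem_nhdsWithin] with γ hγ
      have hγ : (0 : ℝ) < γ := hγ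
      refine ae_of_all _ fun y => ?_
      rw [Real.norm_of_nonneg (div_nonneg (hnn y) (by positivity))]
      rcases eq_or_ne y 0 with rfl | hy
      · simp
      have hy' : 0 < ‖y‖ := norm_pos_iff.2 hy
      refine div_le_div_of_nonneg_left (hnn y) (by positivity) ?_
      rw [← hpow]
      exact Real.rpow_le_rpow (by positivity) (by linarith) hs.le
    · rcases eq_or_ne y 0 with rfl | hy
      · simp
      have hy' : 0 < ‖y‖ := norm_pos_iff.2 hy
      refine Tendsto.div tendsto_const_nhds ?_ (by positivity)
      rw [← hpow]
      refine Tendsto.rpow_const ?_ (Or.inr hs.le)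
      refine Tendsto.mono_left ?_ nhdsWithin_le_nhds
      exact (by fun_prop : Continuous fun γ : ℝ => ‖y‖ ^ 2 + γ).tendsto' 0 _ (by simp)
  rw [integral_one_sub_cos_inner_div d hα0] at hlim
  have h := hlim.const_mul (gammaRatio d α)
  rw [show gammaRatio d α * (‖ξ‖ ^ (2 * α) * stableConst d α) =
    gammaRatio d α * stableConst d α * ‖ξ‖ ^ (2 * α) by ring] at h
  refine h.congr' ?_
  filter_upwards [self_mem_nhdsWithin] with γ hγ
  have hγ : (0 : ℝ) < γ := hγ
  have hγα : γ ^ α ≠ 0 := by positivity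
  rw [jumpExponent, ← integral_const_mul, ← integral_div]
  refine integral_congr_ae (ae_of_all _ fun y => ?_)
  simp only
  field_simp

/-! ### Increments of a process along finitely many times -/

/-- Lévy's convergence theorem for random vectors and an arbitrary countably generated filter. -/
theorem tendstoInDistribution_of_tendsto_charFun {E : Type*} [NormedAddCommGroup E]
    [InnerProductSpace ℝ E] [FiniteDimensional ℝ E] [MeasurableSpace E] [BorelSpace E]
    {ι : Type*} {l : Filter ι} [l.IsCountablyGenerated] {Ω : ι → Type*}
    [∀ i, MeasurableSpace (Ω i)] {μ : ∀ i, Measure (Ω i)} [∀ i, IsProbabilityMeasure (μ i)]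
    {Ω' : Type*} [MeasurableSpace Ω'] {μ' : Measure Ω'} [IsProbabilityMeasure μ']
    {X : ∀ i, Ω i → E} {Z : Ω' → E} (hX : ∀ i, AEMeasurable (X i) (μ i)) (hZ : AEMeasurable Z μ')
    (h : ∀ t, Tendsto (fun i => charFun ((μ i).map (X i)) t) l (𝓝 (charFun (μ'.map Z) t))) :
    TendstoInDistribution X l Z μ μ' where
  forall_aemeasurable := hX
  aemeasurable_limit := hZ
  tendsto := by
    refine tendsto_of_seq_tendsto fun u hu => ?_
    exact ProbabilityMeasure.tendsto_of_tendsto_charFun fun t => (h t).comp hu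

/-- The vector `(X(τ₀), X(τ₁) - X(τ₀), …, X(τₙ) - X(τₙ₋₁))`. -/
def incrementVec {T Ω E : Type*} [Sub E] {n : ℕ} (X : T → Ω → E) (τ : Fin (n + 1) → T) (ω : Ω) :
    Fin (n + 1) → E :=
  Fin.cons (X (τ 0) ω) fun m : Fin n => X (τ m.succ) ω - X (τ m.castSucc) ω

lemma sum_Iic_incrementVec {T Ω E : Type*} [AddCommGroup E] {n : ℕ} (X : T → Ω → E)
    (τ : Fin (n + 1) → T) (ω : Ω) (j : Fin (n + 1)) :
    ∑ m ∈ Finset.Iic j, incrementVec X τ ω m = X (τ j) ω := by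
  induction j using Fin.induction with
  | zero =>
    have : Finset.Iic (0 : Fin (n + 1)) = {0} := by
      ext m; simp
    rw [this, Finset.sum_singleton]
    rfl
  | succ j ih =>
    have : Finset.Iic j.succ = insert j.succ (Finset.Iic j.castSucc) := by
      ext m
      simp only [Finset.mem_Iic, Finset.mem_insert, Fin.le_def, Fin.ext_iff, Fin.val_succ,
        Fin.val_castSucc]
      omega
    rw [this, Finset.sum_insert, ih]
    · simp [incrementVec]
    · simp [Fin.le_def]

lemma measurable_incrementVec {T Ω E : Type*} [MeasurableSpace Ω] [MeasurableSpace E] [Sub E]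
    [MeasurableSub₂ E] {n : ℕ} {X : T → Ω → E} (hX : ∀ t, Measurable (X t))
    (τ : Fin (n + 1) → T) : Measurable (incrementVec X τ) := by
  refine measurable_pi_lambda _ fun m => ?_
  refine Fin.cases ?_ (fun m => ?_) m
  · exact hX _
  · exact (hX _).sub (hX _)

lemma charFun_map_toLp {Ω ι E : Type*} [MeasurableSpace Ω] [Fintype ι] [NormedAddCommGroup E]
    [InnerProductSpace ℝ E] [MeasurableSpace E] [BorelSpace E] [SecondCountableTopology E]
    {P : Measure Ω} {V : Ω → ι → E} (hV : Measurable V) (η : PiLp 2 fun _ : ι => E) :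
    charFun (P.map fun ω => WithLp.toLp 2 (V ω)) η =
      ∫ ω, Complex.exp ((∑ m, inner ℝ (V ω m) (η m) : ℝ) * Complex.I) ∂P := by
  have h : Measurable fun ω => WithLp.toLp 2 (V ω) := (WithLp.measurable_toLp 2 _).comp hV
  rw [charFun_apply, integral_map h.aemeasurable (by fun_prop)]
  simp only [PiLp.inner_apply]

/-! ### Finite-dimensional laws of the stable process -/

lemma integral_exp_incrementVec_stable {Ω : Type*} [MeasurableSpace Ω] {d : ℕ} {β : ℝ}
    {S : ℝ≥0 → Ω → EuclideanSpace ℝ (Fin d)} {P : Measure Ω} [IsProbabilityMeasure P]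
    (hS : IsIsotropicStable β S P) {n : ℕ} {τ : Fin (n + 1) → ℝ≥0} (hτ : Monotone τ)
    (hτ0 : τ 0 = 0) (η : Fin (n + 1) → EuclideanSpace ℝ (Fin d)) :
    ∫ ω, Complex.exp ((∑ m, inner ℝ (incrementVec S τ ω m) (η m) : ℝ) * Complex.I) ∂P =
      ∏ m : Fin n, Complex.exp
        (-((((τ m.succ - τ m.castSucc : ℝ≥0) : ℝ) * ‖η m.succ‖ ^ β : ℝ) : ℂ)) := by
  have h1 : ∀ᵐ ω ∂P,
      Complex.exp ((∑ m, inner ℝ (incrementVec S τ ω m) (η m) : ℝ) * Complex.I) =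
      ∏ m : Fin n, Complex.exp
        ((inner ℝ (S (τ m.succ) ω - S (τ m.castSucc) ω) (η m.succ) : ℝ) * Complex.I) := by
    filter_upwards [hS.zero] with ω hω
    rw [← Complex.exp_sum, ← Finset.sum_mul, Fin.sum_univ_succ]
    simp [incrementVec, hτ0, hω]
  rw [integral_congr_ae h1, (hS.indep_increments n τ hτ).integral_fun_prod_comp
    (f := fun m v => Complex.exp ((inner ℝ v (η (Fin.succ m)) : ℝ) * Complex.I))
    (fun m => ((hS.measurable _).sub (hS.measurable _)).aemeasurable) (fun m => by fun_prop)]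
  refine Finset.prod_congr rfl fun m _ => ?_
  rw [← hS.charFun_eq, ← (hS.stationary_increments (τ m.castSucc) _).map_eq,
    add_tsub_cancel_of_le (hτ (Fin.castSucc_le_succ m)), charFun_apply,
    integral_map ((hS.measurable _).fun_sub (hS.measurable _)).aemeasurable (by fun_prop)]

/-! ### Finite-dimensional laws of the random walk -/

/-- The probability generating function of a Poisson law. -/
lemma integral_pow_poissonMeasure (r : ℝ≥0) (z : ℂ) :
    ∫ n, z ^ n ∂(poissonMeasure r) = Complex.exp (r * (z - 1)) := by
  rw [integral_poissonMeasure]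
  have h : ∀ n : ℕ, (Real.exp (-r) * (r : ℝ) ^ n / n.factorial) • z ^ n =
      Complex.exp (-r) * ((r * z) ^ n / n.factorial) := fun n => by
    rw [Complex.real_smul]
    push_cast
    ring
  simp_rw [h]
  rw [tsum_mul_left, (NormedSpace.expSeries_div_hasSum_exp ((r : ℂ) * z)).tsum_eq,
    ← Complex.exp_eq_exp_ℂ, ← Complex.exp_add]
  congr 1
  ring

/-- The jump law is symmetric, so that the random signs do not change it. -/
lemma integral_exp_sign_smul_jump {Ω : Type*} [MeasurableSpace Ω] {d : ℕ} {α : ℝ} (hα : 0 < α)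
    {rate p q γ : ℝ≥0} (hγ : 0 < γ) (hpq : p + q = 1) {N : ℝ≥0 → Ω → ℕ} {ε : ℕ → Ω → ℝ}
    {Y : ℕ → Ω → EuclideanSpace ℝ (Fin d)} {P : Measure Ω} [IsProbabilityMeasure P]
    (hw : IsRandomWalkInput d α rate p q γ N ε Y P) (j : ℕ) (ξ : EuclideanSpace ℝ (Fin d)) :
    ∫ ω, Complex.exp ((inner ℝ (ε j ω • Y j ω) ξ : ℝ) * Complex.I) ∂P =
      ((1 - jumpExponent d α γ ξ : ℝ) : ℂ) := by
  have := isProbabilityMeasure_jumpLaw d hα γ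
  have hsf : IsFiniteMeasure (signLaw p q) := by unfold signLaw; infer_instance
  have hF : Measurable fun z : ℝ × EuclideanSpace ℝ (Fin d) =>
      Complex.exp ((inner ℝ (z.1 • z.2) ξ : ℝ) * Complex.I) := by fun_prop
  have hlaw : P.map (fun ω => (ε j ω, Y j ω)) = (signLaw p q).prod (jumpLaw d α γ) := by
    rw [(indepFun_iff_map_prod_eq_prod_map_map (hw.measurable_sign j).aemeasurable
      (hw.measurable_jump j).aemeasurable).1 (hw.indep_sign_jump j), (hw.law_sign j).map_eq,
      (hw.law_jump j).map_eq]
  have h1 := integral_map (μ := P) ((hw.measurable_sign j).prodMk (hw.measurable_jump j)).aemeasurable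
    hF.aestronglyMeasurable
  rw [← h1, hlaw, integral_prod]
  swap
  · refine (integrable_const (1 : ℝ)).mono' hF.aestronglyMeasurable (ae_of_all _ fun y => ?_)
    rw [Complex.norm_exp_ofReal_mul_I]
  have h2 : ∀ x : ℝ, ∫ y, Complex.exp ((inner ℝ (x • y) ξ : ℝ) * Complex.I) ∂(jumpLaw d α γ) =
      ((1 - jumpExponent d α γ (x • ξ) : ℝ) : ℂ) := fun x => by
    rw [← charFun_jumpLaw d hα hγ, charFun_apply]
    simp only [real_inner_smul_left, real_inner_smul_right]
  have h3 : jumpExponent d α γ (-ξ) = jumpExponent d α γ ξ := by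
    simp [jumpExponent]
  simp only [h2]
  rw [signLaw, integral_add_measure (.smul_measure_nnreal (integrable_dirac (by simp)))
    (.smul_measure_nnreal (integrable_dirac (by simp))), integral_smul_nnreal_measure,
    integral_smul_nnreal_measure, integral_dirac, integral_dirac, neg_one_smul, one_smul, h3,
    ← add_smul, hpq, one_smul]

/-- Sums of jumps over disjoint blocks of indices are independent. -/
lemma integral_exp_sum_blocks {Ω : Type*} [MeasurableSpace Ω] {d : ℕ} {α : ℝ} (hα : 0 < α)
    {rate p q γ : ℝ≥0} (hγ : 0 < γ) (hpq : p + q = 1) {N : ℝ≥0 → Ω → ℕ} {ε : ℕ → Ω → ℝ}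
    {Y : ℕ → Ω → EuclideanSpace ℝ (Fin d)} {P : Measure Ω} [IsProbabilityMeasure P]
    (hw : IsRandomWalkInput d α rate p q γ N ε Y P) {ι : Type*} [Fintype ι] {B : ι → Finset ℕ}
    (hB : Pairwise fun i j => Disjoint (B i) (B j)) (η : ι → EuclideanSpace ℝ (Fin d)) :
    ∫ ω, Complex.exp ((∑ m, inner ℝ (∑ j ∈ B m, ε j ω • Y j ω) (η m) : ℝ) * Complex.I) ∂P =
      ∏ m, ((1 - jumpExponent d α γ (η m) : ℝ) : ℂ) ^ (B m).card := by
  have hinj : Function.Injective fun s : Σ m, B m => (s.2 : ℕ) := by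
    rintro ⟨m, j, hj⟩ ⟨m', j', hj'⟩ (rfl : j = j')
    obtain rfl : m = m' := by
      by_contra hne
      exact Finset.disjoint_left.1 (hB hne) hj hj'
    rfl
  have h1 : ∀ ω, Complex.exp
      ((∑ m, inner ℝ (∑ j ∈ B m, ε j ω • Y j ω) (η m) : ℝ) * Complex.I) =
      ∏ s : Σ m, B m,
        Complex.exp ((inner ℝ (ε s.2 ω • Y s.2 ω) (η s.1) : ℝ) * Complex.I) := fun ω => by
    rw [← Complex.exp_sum, Fintype.sum_sigma]
    congr 1
    push_cast
    rw [Finset.sum_mul]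
    refine Finset.sum_congr rfl fun m _ => ?_
    rw [Finset.sum_coe_sort (B m)
      (fun j => ((inner ℝ (ε j ω • Y j ω) (η m) : ℝ) : ℂ) * Complex.I), sum_inner,
      Complex.ofReal_sum, Finset.sum_mul]
  simp_rw [h1]
  rw [(hw.indep_pairs.precomp hinj).integral_fun_prod_comp
    (f := fun s z => Complex.exp ((inner ℝ (z.1 • z.2) (η s.1) : ℝ) * Complex.I))
    (fun s => ((hw.measurable_sign _).prodMk (hw.measurable_jump _)).aemeasurable)
    (fun s => by fun_prop), Fintype.prod_sigma]
  refine Finset.prod_congr rfl fun m _ => ?_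
  simp only [integral_exp_sign_smul_jump hα hγ hpq hw]
  simp

/-- The blocks `{0, …, n₀}`, `{n₀ + 1, …, n₁}`, …, `{nₖ₋₁ + 1, …, nₖ}` of indices of the jumps which
make up the increments of the walk, when the Poisson process takes the values `n`. -/
def jumpBlock {k : ℕ} (n : Fin (k + 1) → ℕ) : Fin (k + 1) → Finset ℕ :=
  Fin.cons (Finset.range (n 0 + 1)) fun m : Fin k =>
    Finset.Ico (n m.castSucc + 1) (n m.succ + 1)

lemma pairwise_disjoint_jumpBlock {k : ℕ} {n : Fin (k + 1) → ℕ} (hn : Monotone n) :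
    Pairwise fun i j => Disjoint (jumpBlock n i) (jumpBlock n j) := by
  have hlt : ∀ i j, i < j → Disjoint (jumpBlock n i) (jumpBlock n j) := by
    intro i j hij
    rw [Finset.disjoint_left]
    intro a ha hb
    obtain ⟨j, rfl⟩ := Fin.exists_succ_eq.2 (Fin.pos_iff_ne_zero.1 ((Fin.zero_le i).trans_lt hij))
    have h1 : a < n i + 1 := by
      revert ha
      refine Fin.cases ?_ (fun i => ?_) i
      · simp [jumpBlock]
      · simp [jumpBlock]
    have h2 : n j.castSucc + 1 ≤ a := by
      simp only [jumpBlock, Fin.cons_succ, Finset.mem_Ico] at hb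
      exact hb.1
    have h3 : n i ≤ n j.castSucc := hn (Fin.le_castSucc_iff.2 hij)
    omega
  intro i j hij
  rcases lt_or_gt_of_ne hij with h | h
  · exact hlt i j h
  · exact (hlt j i h).symm

lemma measurable_randomWalk {Ω : Type*} [MeasurableSpace Ω] {d : ℕ} {α : ℝ} {rate p q γ : ℝ≥0}
    {N : ℝ≥0 → Ω → ℕ} {ε : ℕ → Ω → ℝ} {Y : ℕ → Ω → EuclideanSpace ℝ (Fin d)} {P : Measure Ω}
    (hw : IsRandomWalkInput d α rate p q γ N ε Y P) (t : ℝ≥0) :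
    Measurable (randomWalk N ε Y t) := by
  have h : Measurable fun z : ℕ × Ω => ∑ j ∈ Finset.range (z.1 + 1), ε j z.2 • Y j z.2 :=
    measurable_from_prod_countable_right fun n =>
      Finset.measurable_fun_sum (Finset.range (n + 1)) fun j _ =>
        (hw.measurable_sign j).fun_smul (hw.measurable_jump j)
  exact h.comp ((hw.poisson.measurable t).prodMk measurable_id)

/-- Given the Poisson process, the increments of the walk are sums over disjoint blocks of jumps;
the numbers of jumps in these blocks are independent Poisson variables. -/
theorem integral_exp_incrementVec_randomWalk {Ω : Type*} [MeasurableSpace Ω] {d : ℕ} {α : ℝ}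
    (hα : 0 < α) {rate p q γ : ℝ≥0} (hγ : 0 < γ) (hpq : p + q = 1) {N : ℝ≥0 → Ω → ℕ}
    {ε : ℕ → Ω → ℝ} {Y : ℕ → Ω → EuclideanSpace ℝ (Fin d)} {P : Measure Ω}
    [IsProbabilityMeasure P] (hw : IsRandomWalkInput d α rate p q γ N ε Y P) {k : ℕ}
    {τ : Fin (k + 1) → ℝ≥0} (hτ : Monotone τ) (hτ0 : τ 0 = 0)
    (η : Fin (k + 1) → EuclideanSpace ℝ (Fin d)) :
    ∫ ω, Complex.exp
        ((∑ m, inner ℝ (incrementVec (randomWalk N ε Y) τ ω m) (η m) : ℝ) * Complex.I) ∂P =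
      ((1 - jumpExponent d α γ (η 0) : ℝ) : ℂ) * ∏ m : Fin k,
        Complex.exp ((rate * (τ m.succ - τ m.castSucc) : ℝ≥0) *
          (((1 - jumpExponent d α γ (η m.succ) : ℝ) : ℂ) - 1)) := by
  set c : Fin (k + 1) → ℂ := fun m => ((1 - jumpExponent d α γ (η m) : ℝ) : ℂ) with hc
  set Z : Ω → ℕ → ℝ × EuclideanSpace ℝ (Fin d) := fun ω j => (ε j ω, Y j ω) with hZ
  set M : Ω → Fin (k + 1) → ℕ := fun ω m => N (τ m) ω with hM
  have hZm : Measurable Z := measurable_pi_lambda _ fun j =>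
    (hw.measurable_sign j).prodMk (hw.measurable_jump j)
  have hMm : Measurable M := measurable_pi_lambda _ fun m => hw.poisson.measurable _
  have hmono : ∀ᵐ ω ∂P, Monotone (M ω) := by
    filter_upwards [hw.poisson.mono] with ω hω
    exact hω.comp hτ
  have hind : IndepFun M Z P :=
    hw.indep_poisson.comp (φ := fun (f : ℝ≥0 → ℕ) m => f (τ m))
      (measurable_pi_lambda _ fun m => measurable_pi_apply _) measurable_id
  -- the increments as a function of the values of the Poisson process and of the jumps
  set F : (Fin (k + 1) → ℕ) × (ℕ → ℝ × EuclideanSpace ℝ (Fin d)) → ℂ := fun x =>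
    Complex.exp ((∑ m, inner ℝ (∑ j ∈ jumpBlock x.1 m, (x.2 j).1 • (x.2 j).2) (η m) : ℝ) *
      Complex.I) with hF
  have hFm : Measurable F := measurable_from_prod_countable_right fun n => by
    simp only [hF]
    refine Complex.measurable_exp.comp (Measurable.mul_const (Complex.measurable_ofReal.comp ?_) _)
    refine Finset.measurable_fun_sum _ fun m _ => Measurable.inner ?_ measurable_const
    refine Finset.measurable_fun_sum _ fun j _ => ?_
    fun_prop
  have hFi : Integrable F ((P.map M).prod (P.map Z)) := by
    have := Measure.isProbabilityMeasure_map (μ := P) hMm.aemeasurable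
    have := Measure.isProbabilityMeasure_map (μ := P) hZm.aemeasurable
    refine (integrable_const (1 : ℝ)).mono' hFm.aestronglyMeasurable (ae_of_all _ fun x => ?_)
    rw [Complex.norm_exp_ofReal_mul_I]
  have h1 : ∀ᵐ ω ∂P, Complex.exp
      ((∑ m, inner ℝ (incrementVec (randomWalk N ε Y) τ ω m) (η m) : ℝ) * Complex.I) =
      F (M ω, Z ω) := by
    filter_upwards [hmono] with ω hω
    simp only [hF]
    congr 4
    funext m
    congr 1
    refine Fin.cases ?_ (fun m => ?_) m
    · rfl
    · have hle : M ω m.castSucc + 1 ≤ M ω m.succ + 1 :=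
        Nat.succ_le_succ (hω (Fin.castSucc_le_succ m))
      simp only [incrementVec, jumpBlock, Fin.cons_succ, randomWalk]
      rw [Finset.sum_Ico_eq_sub _ hle]
  rw [integral_congr_ae h1, ← integral_map (hMm.prodMk hZm).aemeasurable hFm.aestronglyMeasurable,
    (indepFun_iff_map_prod_eq_prod_map_map hMm.aemeasurable hZm.aemeasurable).1 hind,
    integral_prod _ hFi]
  have h2 : ∀ n, ∫ z, F (n, z) ∂(P.map Z) = ∫ ω, F (n, Z ω) ∂P := fun n =>
    integral_map hZm.aemeasurable (hFm.comp measurable_prodMk_left).aestronglyMeasurable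
  simp_rw [h2]
  rw [integral_map hMm.aemeasurable (Measurable.of_discrete).aestronglyMeasurable]
  have h3 : ∀ᵐ ω ∂P, ∫ ω', F (M ω, Z ω') ∂P =
      c 0 * ∏ m : Fin k, c m.succ ^ (N (τ m.succ) ω - N (τ m.castSucc) ω) := by
    filter_upwards [hmono, hw.poisson.zero] with ω hω hω0
    refine (integral_exp_sum_blocks hα hγ hpq hw (pairwise_disjoint_jumpBlock hω) η).trans ?_
    rw [Fin.prod_univ_succ]
    simp [jumpBlock, hM, hτ0, hω0, hc]
  rw [integral_congr_ae h3, integral_const_mul]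
  congr 1
  rw [(hw.poisson.indep_increments k τ hτ).integral_fun_prod_comp
    (f := fun m (n : ℕ) => c (Fin.succ m) ^ n)
    (fun m => ((hw.poisson.measurable _).sub (hw.poisson.measurable _)).aemeasurable)
    (fun m => (Measurable.of_discrete).aestronglyMeasurable)]
  refine Finset.prod_congr rfl fun m _ => ?_
  rw [← integral_pow_poissonMeasure, ← (hw.poisson.increments (τ m.castSucc) _).map_eq,
    add_tsub_cancel_of_le (hτ (Fin.castSucc_le_succ m)),
    integral_map ((hw.poisson.measurable _).fun_sub (hw.poisson.measurable _)).aemeasurable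
      (Measurable.of_discrete).aestronglyMeasurable]

/-! ### Convergence of the finite-dimensional laws -/

lemma tendsto_coe_posNNReal :
    Tendsto (fun γ : {γ : ℝ≥0 // 0 < γ} => ((γ : ℝ≥0) : ℝ)) (comap Subtype.val (𝓝 0)) (𝓝[>] 0) :=
  tendsto_nhdsWithin_iff.2 ⟨(NNReal.continuous_coe.tendsto' 0 0 rfl).comp tendsto_comap,
    Eventually.of_forall fun γ => NNReal.coe_pos.2 γ.2⟩

lemma starTime_mono (d : ℕ) [NeZero d] (α : ℝ) (rate : ℝ≥0) : Monotone (starTime d α rate) :=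
  fun _ _ h => mul_le_mul_right h _

/-- The mean number of jumps in the time `h / γ ^ α`, times the exponent of one jump, tends to the
exponent of the stable process. -/
lemma tendsto_exp_rate_mul_jumpExponent (d : ℕ) [NeZero d] {α : ℝ} (hα0 : 0 < α) (hα1 : α < 1)
    (rate : ℝ≥0) {a b : ℝ≥0} (hab : a ≤ b) (ξ : EuclideanSpace ℝ (Fin d)) :
    Tendsto (fun γ : {γ : ℝ≥0 // 0 < γ} =>
        Complex.exp ((rate * (b / (γ : ℝ≥0) ^ α - a / (γ : ℝ≥0) ^ α) : ℝ≥0) *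
          (((1 - jumpExponent d α (γ : ℝ≥0) ξ : ℝ) : ℂ) - 1)))
      (comap Subtype.val (𝓝 0))
      (𝓝 (Complex.exp (-((((starTime d α rate b - starTime d α rate a : ℝ≥0) : ℝ) *
        ‖ξ‖ ^ (2 * α) : ℝ) : ℂ)))) := by
  have h := ((tendsto_jumpExponent_div d hα0 hα1 ξ).comp tendsto_coe_posNNReal).const_mul (-(rate * (b - a) : ℝ))
  refine (Complex.continuous_exp.tendsto _).comp ?_
  have h2 := (Complex.continuous_ofReal.tendsto _).comp h
  rw [NNReal.coe_sub (starTime_mono d α rate hab), coe_starTime d hα0, coe_starTime d hα0]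
  convert! h2 using 1
  · funext γ
    have hγα : (0 : ℝ) < ((γ : ℝ≥0) : ℝ) ^ α := by
      have : (0 : ℝ) < (γ : ℝ≥0) := NNReal.coe_pos.2 γ.2
      positivity
    have hc : (((rate * (b / (γ : ℝ≥0) ^ α - a / (γ : ℝ≥0) ^ α) : ℝ≥0) : ℝ)) =
        rate * (b - a) / ((γ : ℝ≥0) : ℝ) ^ α := by
      rw [NNReal.coe_mul, NNReal.coe_sub (by gcongr), NNReal.coe_div, NNReal.coe_div,
        NNReal.coe_rpow]
      ring
    simp only [Function.comp_apply]
    rw [← Complex.ofReal_one, ← Complex.ofReal_sub]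
    rw [show (((rate * (b / (γ : ℝ≥0) ^ α - a / (γ : ℝ≥0) ^ α) : ℝ≥0) : ℂ)) =
      (((rate * (b / (γ : ℝ≥0) ^ α - a / (γ : ℝ≥0) ^ α) : ℝ≥0) : ℝ) : ℂ) from rfl, hc,
      ← Complex.ofReal_mul]
    congr 1
    field_simp
    ring
  · rw [← Complex.ofReal_neg]
    congr 2
    ring

lemma tendsto_jumpExponent (d : ℕ) [NeZero d] {α : ℝ} (hα0 : 0 < α) (hα1 : α < 1)
    (ξ : EuclideanSpace ℝ (Fin d)) :
    Tendsto (fun γ : ℝ => jumpExponent d α γ ξ) (𝓝[>] 0) (𝓝 0) := by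
  have h1 : Tendsto (fun γ : ℝ => γ ^ α) (𝓝[>] 0) (𝓝 0) := by
    refine Tendsto.mono_left ?_ nhdsWithin_le_nhds
    exact (Real.continuous_rpow_const hα0.le).tendsto' 0 0 (Real.zero_rpow hα0.ne')
  have h2 := (tendsto_jumpExponent_div d hα0 hα1 ξ).mul h1
  rw [mul_zero] at h2
  refine h2.congr' ?_
  filter_upwards [self_mem_nhdsWithin] with γ hγ
  have hγ : (0 : ℝ) < γ := hγ
  exact div_mul_cancel₀ _ (by positivity)

/-- The increments along an increasing sequence of times starting at `0` converge jointly, by Lévy's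
theorem; the values of the processes at unordered times are continuous functions of increments. -/
theorem tendstoInDistribution_randomWalk (d : ℕ) [NeZero d] {α : ℝ} (hα0 : 0 < α) (hα1 : α < 1)
    {rate p q : ℝ≥0} (hpq : p + q = 1) {Ω : {γ : ℝ≥0 // 0 < γ} → Type*}
    [∀ γ, MeasurableSpace (Ω γ)] {P : ∀ γ, Measure (Ω γ)} [∀ γ, IsProbabilityMeasure (P γ)]
    {N : ∀ γ, ℝ≥0 → Ω γ → ℕ} {ε : ∀ γ, ℕ → Ω γ → ℝ}
    {Y : ∀ γ, ℕ → Ω γ → EuclideanSpace ℝ (Fin d)}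
    (hwalk : ∀ γ : {γ : ℝ≥0 // 0 < γ},
      IsRandomWalkInput d α rate p q γ (N γ) (ε γ) (Y γ) (P γ))
    {Ω' : Type*} [MeasurableSpace Ω'] {P' : Measure Ω'} [IsProbabilityMeasure P']
    {S : ℝ≥0 → Ω' → EuclideanSpace ℝ (Fin d)} (hS : IsIsotropicStable (2 * α) S P') (k : ℕ)
    (t : Fin k → ℝ≥0) :
    TendstoInDistribution
      (fun (γ : {γ : ℝ≥0 // 0 < γ}) ω i =>
        randomWalk (N γ) (ε γ) (Y γ) (t i / (γ : ℝ≥0) ^ α) ω)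
      (comap Subtype.val (𝓝 0))
      (fun ω i => S (starTime d α rate (t i)) ω) P P' := by
  set σ := Tuple.sort t with hσ
  -- the increasing rearrangement of the times, preceded by `0`
  set τ : Fin (k + 1) → ℝ≥0 := Fin.cons 0 (t ∘ σ) with hτ
  have hτmono : Monotone τ := by
    refine Fin.monotone_iff_le_succ.2 fun i => ?_
    rw [hτ, Fin.cons_succ]
    cases k with
    | zero => exact i.elim0
    | succ k =>
      refine Fin.cases ?_ (fun i => ?_) i
      · simp
      · rw [← Fin.succ_castSucc, Fin.cons_succ]
        exact Tuple.monotone_sort t (Fin.castSucc_le_succ i)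
  have hτt : ∀ i, τ (σ.symm i).succ = t i := fun i => by simp [hτ]
  set A : ∀ γ : {γ : ℝ≥0 // 0 < γ}, ℝ≥0 → Ω γ → EuclideanSpace ℝ (Fin d) := fun γ =>
    randomWalk (N γ) (ε γ) (Y γ) with hA
  set τA : {γ : ℝ≥0 // 0 < γ} → Fin (k + 1) → ℝ≥0 := fun γ m => τ m / (γ : ℝ≥0) ^ α with hτA
  set τS : Fin (k + 1) → ℝ≥0 := fun m => starTime d α rate (τ m) with hτS
  have hAm : ∀ γ, Measurable (incrementVec (A γ) (τA γ)) := fun γ =>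
    measurable_incrementVec (measurable_randomWalk (hwalk γ)) _
  have hSm : Measurable (incrementVec S τS) := measurable_incrementVec hS.measurable _
  have key : TendstoInDistribution
      (fun γ ω => WithLp.toLp 2 (incrementVec (A γ) (τA γ) ω)) (comap Subtype.val (𝓝 0))
      (fun ω => WithLp.toLp 2 (incrementVec S τS ω)) P P' := by
    refine tendstoInDistribution_of_tendsto_charFun
      (fun γ => ((WithLp.measurable_toLp 2 _).comp (hAm γ)).aemeasurable)
      ((WithLp.measurable_toLp 2 _).comp hSm).aemeasurable fun η => ?_
    rw [charFun_map_toLp hSm, integral_exp_incrementVec_stable hS (τ := τS)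
      ((starTime_mono d α rate).comp hτmono) (by simp [hτS, hτ, starTime])]
    have hcongr : ∀ γ : {γ : ℝ≥0 // 0 < γ},
        charFun ((P γ).map fun ω => WithLp.toLp 2 (incrementVec (A γ) (τA γ) ω)) η =
        ((1 - jumpExponent d α (γ : ℝ≥0) (η 0) : ℝ) : ℂ) * ∏ m : Fin k,
          Complex.exp ((rate * (τA γ m.succ - τA γ m.castSucc) : ℝ≥0) *
            (((1 - jumpExponent d α (γ : ℝ≥0) (η m.succ) : ℝ) : ℂ) - 1)) := fun γ => by
      rw [charFun_map_toLp (hAm γ)]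
      refine integral_exp_incrementVec_randomWalk hα0 γ.2 hpq (hwalk γ) (fun i j hij => ?_)
        (by simp [hτA, hτ]) η
      exact div_le_div_of_nonneg_right (hτmono hij) zero_le
    simp_rw [hcongr]
    rw [← one_mul (∏ m : Fin k, _)]
    refine Tendsto.mul ?_ (tendsto_finsetProd _ fun m _ =>
      tendsto_exp_rate_mul_jumpExponent d hα0 hα1 rate (hτmono (Fin.castSucc_le_succ m)) _)
    refine (Complex.continuous_ofReal.tendsto' 1 1 rfl).comp ?_
    simpa using ((tendsto_jumpExponent d hα0 hα1 (η 0)).comp tendsto_coe_posNNReal).const_sub 1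
  have hΦ : Continuous fun (v : PiLp 2 fun _ : Fin (k + 1) => EuclideanSpace ℝ (Fin d))
      (i : Fin k) => ∑ m ∈ Finset.Iic (σ.symm i).succ, v m := by fun_prop
  convert! key.continuous_comp hΦ using 1
  · funext γ ω i
    simp only [Function.comp_apply]
    rw [sum_Iic_incrementVec]
    simp only [hA, hτA, hτt]
  · funext ω i
    simp only [Function.comp_apply]
    rw [sum_Iic_incrementVec]
    simp only [hτS, hτt]

/-! ### The generator of the stable process -/

lemma abs_exp_neg_sub_one_add_le {u : ℝ} (hu : 0 ≤ u) : |Real.exp (-u) - 1 + u| ≤ u ^ 2 / 2 := by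
  have h1 : 0 ≤ Real.exp (-u) - 1 + u := by linarith [Real.add_one_le_exp (-u)]
  rw [abs_of_nonneg h1]
  have h2 := Real.quadratic_le_exp_of_nonneg hu
  have h3 : 0 < Real.exp u := Real.exp_pos u
  rw [Real.exp_neg]
  have h4 : (Real.exp u)⁻¹ ≤ (1 + u + u ^ 2 / 2)⁻¹ := inv_anti₀ (by positivity) h2
  have h5 : (1 + u + u ^ 2 / 2)⁻¹ ≤ 1 - u + u ^ 2 / 2 := by
    rw [inv_le_iff_one_le_mul₀ (by positivity)]
    nlinarith [sq_nonneg (u ^ 2)]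
  linarith

lemma integrable_rpow_norm_mul_schwartz {d : ℕ} {s : ℝ} (hs : 0 ≤ s) {k : ℕ} (hk : s ≤ k)
    (f : 𝓢(EuclideanSpace ℝ (Fin d), ℂ)) :
    Integrable fun ξ : EuclideanSpace ℝ (Fin d) => (2 * Real.pi * ‖ξ‖) ^ s * ‖f ξ‖ := by
  have h0 := (f.integrable (μ := volume)).norm
  have h1 := (f.integrable_pow_mul volume k).const_mul ((2 * Real.pi) ^ k)
  have hm : Measurable fun ξ : EuclideanSpace ℝ (Fin d) => (2 * Real.pi * ‖ξ‖) ^ s * ‖f ξ‖ :=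
    (by fun_prop : Measurable fun ξ : EuclideanSpace ℝ (Fin d) =>
      (2 * Real.pi * ‖ξ‖) ^ s).mul f.continuous.measurable.norm
  refine (h0.add h1).mono' hm.aestronglyMeasurable (ae_of_all _ fun ξ => ?_)
  have hx : 0 ≤ 2 * Real.pi * ‖ξ‖ := by positivity
  have hle : (2 * Real.pi * ‖ξ‖) ^ s ≤ 1 + (2 * Real.pi * ‖ξ‖) ^ k := by
    rcases le_total (2 * Real.pi * ‖ξ‖) 1 with h | h
    · linarith [Real.rpow_le_one hx h hs, pow_nonneg hx k]
    · have := Real.rpow_le_rpow_of_exponent_le h hk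
      rw [Real.rpow_natCast] at this
      linarith
  rw [Real.norm_of_nonneg (by positivity)]
  refine (mul_le_mul_of_nonneg_right hle (norm_nonneg _)).trans_eq ?_
  simp only [Pi.add_apply]
  rw [mul_pow]
  ring

/-- Fourier inversion for Schwartz functions, with the kernel written out. -/
lemma schwartz_eq_integral_exp_mul_fourier {d : ℕ} (f : 𝓢(EuclideanSpace ℝ (Fin d), ℂ))
    (x : EuclideanSpace ℝ (Fin d)) :
    f x = ∫ ξ : EuclideanSpace ℝ (Fin d),
      Complex.exp ((2 * Real.pi * inner ℝ ξ x : ℝ) * Complex.I) * (𝓕 f) ξ := by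
  have h : 𝓕⁻ (𝓕 f) = f := FourierPair.fourierInv_fourier_eq f
  conv_lhs => rw [← h]
  rw [SchwartzMap.fourierInv_coe, Real.fourierInv_eq']
  simp only [smul_eq_mul]

/-- By Fourier inversion and Fubini, the transition operators of a process act as Fourier
multipliers given by its characteristic functions. -/
lemma transitionOp_eq_integral {Ω : Type*} [MeasurableSpace Ω] {d : ℕ}
    {X : ℝ≥0 → Ω → EuclideanSpace ℝ (Fin d)} {P : Measure Ω} [IsProbabilityMeasure P]
    (hX : ∀ t, Measurable (X t)) (t : ℝ≥0) (f : 𝓢(EuclideanSpace ℝ (Fin d), ℂ))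
    (x : EuclideanSpace ℝ (Fin d)) :
    transitionOp X P t f x = ∫ ξ : EuclideanSpace ℝ (Fin d),
      Complex.exp ((2 * Real.pi * inner ℝ ξ x : ℝ) * Complex.I) *
        (charFun (P.map (X t)) ((2 * Real.pi) • ξ) * (𝓕 f) ξ) := by
  rw [transitionOp]
  simp_rw [schwartz_eq_integral_exp_mul_fourier f]
  rw [integral_integral_swap]
  · refine integral_congr_ae (ae_of_all _ fun ξ => ?_)
    simp only
    rw [charFun_apply, integral_map (hX t).aemeasurable (by fun_prop), ← mul_assoc,
      ← integral_const_mul, ← integral_mul_const]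
    refine integral_congr_ae (ae_of_all _ fun ω => ?_)
    simp only
    rw [← Complex.exp_add, ← add_mul, ← Complex.ofReal_add, inner_add_right,
      real_inner_smul_right, real_inner_comm ξ]
    congr 4
    ring
  · have hbase : Integrable (fun z : Ω × EuclideanSpace ℝ (Fin d) => ‖(𝓕 f) z.2‖)
        (P.prod volume) := ((𝓕 f).integrable (μ := volume)).norm.comp_snd P
    have hm : Measurable fun z : Ω × EuclideanSpace ℝ (Fin d) =>
        Complex.exp ((2 * Real.pi * inner ℝ z.2 (x + X t z.1) : ℝ) * Complex.I) *
          (𝓕 f) z.2 := by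
      refine Measurable.mul ?_ ((𝓕 f).continuous.measurable.comp measurable_snd)
      refine Complex.measurable_exp.comp
        (Measurable.mul_const (Complex.measurable_ofReal.comp ?_) _)
      exact (measurable_snd.inner (((hX t).comp measurable_fst).const_add x)).const_mul _
    refine hbase.mono' hm.aestronglyMeasurable (ae_of_all _ fun z => ?_)
    rw [Function.uncurry_apply_pair, norm_mul, Complex.norm_exp_ofReal_mul_I, one_mul]

/-- The difference quotient and the generator are both Fourier multipliers, and their symbols
differ by at most `h c² (2π|ξ|) ^ (4α) / 2`, which is integrable against the Fourier transform of a
Schwartz function; hence the convergence is uniform, with a rate linear in `h`. -/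
theorem generatorMapsTo_of_charFun {Ω : Type*} [MeasurableSpace Ω] {d : ℕ} {α : ℝ} (hα0 : 0 < α)
    (hα1 : α < 1) {c : ℝ} (hc : 0 ≤ c) {X : ℝ≥0 → Ω → EuclideanSpace ℝ (Fin d)} {P : Measure Ω}
    [IsProbabilityMeasure P] (hX : ∀ t, Measurable (X t))
    (hchar : ∀ t ξ, charFun (P.map (X t)) ξ = Complex.exp (-((c * t * ‖ξ‖ ^ (2 * α) : ℝ) : ℂ)))
    (f : 𝓢(EuclideanSpace ℝ (Fin d), ℂ)) :
    GeneratorMapsTo X P f fun x => -(c : ℂ) * fracLaplacian α f x := by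
  set s : EuclideanSpace ℝ (Fin d) → ℝ := fun ξ => (2 * Real.pi * ‖ξ‖) ^ (2 * α) with hs
  have hs0 : ∀ ξ, 0 ≤ s ξ := fun ξ => by simp only [hs]; positivity
  have hsm : Measurable s := by fun_prop
  have hs2 : ∀ ξ, s ξ ^ 2 = (2 * Real.pi * ‖ξ‖) ^ (4 * α) := fun ξ => by
    simp only [hs]
    rw [← Real.rpow_natCast, ← Real.rpow_mul (by positivity)]
    congr 1
    push_cast
    ring
  set e : EuclideanSpace ℝ (Fin d) → EuclideanSpace ℝ (Fin d) → ℂ := fun x ξ =>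
    Complex.exp ((2 * Real.pi * inner ℝ ξ x : ℝ) * Complex.I) with he
  have hem : ∀ x, Measurable (e x) := fun x => by fun_prop
  have hen : ∀ x ξ, ‖e x ξ‖ = 1 := fun x ξ => Complex.norm_exp_ofReal_mul_I _
  set g : 𝓢(EuclideanSpace ℝ (Fin d), ℂ) := 𝓕 f with hg
  have hfm : Measurable g := g.continuous.measurable
  have hfi : Integrable g := g.integrable
  have hsi : Integrable fun ξ => s ξ * ‖g ξ‖ :=
    integrable_rpow_norm_mul_schwartz (k := 2) (by positivity) (by push_cast; linarith) g
  have hs2i : Integrable fun ξ => s ξ ^ 2 * ‖g ξ‖ := by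
    simp_rw [hs2]
    exact integrable_rpow_norm_mul_schwartz (k := 4) (by positivity) (by push_cast; linarith) g
  have hinv : ∀ x, f x = ∫ ξ, e x ξ * g ξ := schwartz_eq_integral_exp_mul_fourier f
  have hlap : ∀ x, fracLaplacian α f x = ∫ ξ, e x ξ * ((s ξ : ℂ) * g ξ) := fun x => by
    rw [fracLaplacian, Real.fourierInv_eq']
    simp only [smul_eq_mul, he, hs, hg, SchwartzMap.fourier_coe]
  have htrans : ∀ h x, transitionOp X P h f x =
      ∫ ξ, e x ξ * ((Real.exp (-(h * (c * s ξ))) : ℂ) * g ξ) := fun h x => by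
    rw [transitionOp_eq_integral hX]
    refine integral_congr_ae (ae_of_all _ fun ξ => ?_)
    simp only [hchar, he, hs]
    rw [norm_smul, Real.norm_of_nonneg (by positivity : 0 ≤ 2 * Real.pi), Complex.ofReal_exp]
    congr 3
    push_cast
    ring
  have hi0 : ∀ x, Integrable fun ξ => e x ξ * g ξ := fun x =>
    hfi.norm.mono' ((hem x).mul hfm).aestronglyMeasurable
      (ae_of_all _ fun ξ => by rw [norm_mul, hen, one_mul])
  have hi1 : ∀ x, Integrable fun ξ => e x ξ * ((s ξ : ℂ) * g ξ) := fun x =>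
    hsi.mono' ((hem x).mul ((Complex.measurable_ofReal.comp hsm).mul hfm)).aestronglyMeasurable
      (ae_of_all _ fun ξ => by
        rw [norm_mul, hen, one_mul, norm_mul, Complex.norm_real, Real.norm_of_nonneg (hs0 ξ)])
  have hi2 : ∀ (h : ℝ≥0) x, Integrable fun ξ =>
      e x ξ * ((Real.exp (-(h * (c * s ξ))) : ℂ) * g ξ) := fun h x =>
    hfi.norm.mono' ((hem x).mul ((Complex.measurable_ofReal.comp (by fun_prop)).mul
      hfm)).aestronglyMeasurable (ae_of_all _ fun ξ => by
        rw [norm_mul, hen, one_mul, norm_mul, Complex.norm_real,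
          Real.norm_of_nonneg (Real.exp_pos _).le]
        refine mul_le_of_le_one_left (norm_nonneg _) (Real.exp_le_one_iff.2 ?_)
        have := hs0 ξ
        have : 0 ≤ (h : ℝ) * (c * s ξ) := by positivity
        linarith)
  set K : ℝ := ∫ ξ, c ^ 2 / 2 * (s ξ ^ 2 * ‖g ξ‖) with hK
  have hbound : ∀ h : ℝ≥0, 0 < h → ∀ x,
      ‖-(c : ℂ) * fracLaplacian α f x - (transitionOp X P h f x - f x) / ((h : ℝ) : ℂ)‖ ≤
        h * K := fun h hh x => by
    have hh' : (0 : ℝ) < h := by exact_mod_cast hh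
    have hhc : ((h : ℝ) : ℂ) ≠ 0 := by exact_mod_cast hh'.ne'
    have hdiff : -(c : ℂ) * fracLaplacian α f x -
        (transitionOp X P h f x - f x) / ((h : ℝ) : ℂ) =
        ∫ ξ, -(((Real.exp (-(h * (c * s ξ))) - 1 + h * (c * s ξ)) / h : ℝ) : ℂ) *
          (e x ξ * g ξ) := by
      rw [htrans, hinv, hlap, ← integral_sub (hi2 h x) (hi0 x), ← integral_div,
        ← integral_const_mul]
      refine (integral_sub ((hi1 x).const_mul _)
        (((hi2 h x).sub (hi0 x)).div_const _)).symm.trans ?_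
      refine integral_congr_ae (ae_of_all _ fun ξ => ?_)
      simp only [Pi.sub_apply]
      push_cast
      field_simp
      ring
    rw [hdiff, hK, ← integral_const_mul]
    refine norm_integral_le_of_norm_le ((hs2i.const_mul _).const_mul _) (ae_of_all _ fun ξ => ?_)
    have hu : 0 ≤ (h : ℝ) * (c * s ξ) := mul_nonneg hh'.le (mul_nonneg hc (hs0 ξ))
    rw [norm_mul, norm_neg, Complex.norm_real, norm_mul, hen, one_mul, Real.norm_eq_abs, abs_div,
      abs_of_pos hh', div_mul_eq_mul_div, div_le_iff₀ hh']
    calc _ ≤ ((h : ℝ) * (c * s ξ)) ^ 2 / 2 * ‖g ξ‖ :=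
          mul_le_mul_of_nonneg_right (abs_exp_neg_sub_one_add_le hu) (norm_nonneg _)
      _ = _ := by ring
  rw [GeneratorMapsTo, Metric.tendstoUniformly_iff]
  intro δ hδ
  have hlim : Tendsto (fun h : ℝ≥0 => (h : ℝ) * K) (𝓝[>] 0) (𝓝 0) := by
    refine Tendsto.mono_left ?_ nhdsWithin_le_nhds
    exact (by fun_prop : Continuous fun h : ℝ≥0 => (h : ℝ) * K).tendsto' 0 0 (by simp)
  filter_upwards [hlim.eventually_lt_const hδ, self_mem_nhdsWithin] with h hlt hpos x
  rw [dist_eq_norm]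
  exact (hbound h hpos x).trans_lt hlt

/-! ### The limit theorem -/

theorem theorem1p3 (d : ℕ) [NeZero d] (α : ℝ) (hα0 : 0 < α) (hα1 : α < 1)
    (rate : ℝ≥0) (hrate : 0 < rate) (p q : ℝ≥0) (hpq : p + q = 1)
    -- for every parameter `γ > 0`, a random walk built from jumps with that parameter
    {Ω : {γ : ℝ≥0 // 0 < γ} → Type*} [∀ γ, MeasurableSpace (Ω γ)]
    (P : ∀ γ, Measure (Ω γ)) [∀ γ, IsProbabilityMeasure (P γ)]
    (N : ∀ γ, ℝ≥0 → Ω γ → ℕ) (ε : ∀ γ, ℕ → Ω γ → ℝ)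
    (Y : ∀ γ, ℕ → Ω γ → EuclideanSpace ℝ (Fin d))
    (hwalk : ∀ γ : {γ : ℝ≥0 // 0 < γ},
      IsRandomWalkInput d α rate p q γ (N γ) (ε γ) (Y γ) (P γ))
    -- an isotropic `2α`-stable process
    {Ω' : Type*} [MeasurableSpace Ω'] (P' : Measure Ω') [IsProbabilityMeasure P']
    (S : ℝ≥0 → Ω' → EuclideanSpace ℝ (Fin d)) (hS : IsIsotropicStable (2 * α) S P') :
    -- the density of the jumps
    (∀ γ : ℝ≥0, 0 < γ → jumpLaw d α γ = volume.withDensity (fun y =>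
      ENNReal.ofReal
        (gammaRatio d α * ((γ : ℝ) ^ α / (‖y‖ ^ 2 + γ) ^ (α + (d : ℝ) / 2))))) ∧
    -- the constant `C` is a convergent integral
    Integrable (stableIntegrand d α) ∧
    -- convergence in distribution of the processes, at any finite number of times
    (∀ (k : ℕ) (t : Fin k → ℝ≥0),
      TendstoInDistribution
        (fun (γ : {γ : ℝ≥0 // 0 < γ}) ω i =>
          randomWalk (N γ) (ε γ) (Y γ) (t i / (γ : ℝ≥0) ^ α) ω)
        (comap Subtype.val (𝓝 0))
        (fun ω i => S (starTime d α rate (t i)) ω) P P') ∧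
    -- the generator of the limit process
    (∀ f : 𝓢(EuclideanSpace ℝ (Fin d), ℂ),
      GeneratorMapsTo (fun t => S (starTime d α rate t)) P' f (fun x =>
        -((rate * gammaRatio d α * stableConst d α : ℝ) : ℂ) * fracLaplacian α f x)) := by
  have hc : 0 ≤ rate * gammaRatio d α * stableConst d α :=
    mul_nonneg (mul_nonneg rate.2 (gammaRatio_nonneg d hα0)) (stableConst_nonneg d α)
  refine ⟨fun γ hγ => jumpLaw_eq_withDensity d hα0 hγ, integrable_stableIntegrand d hα0 hα1,
    fun k t => tendstoInDistribution_randomWalk d hα0 hα1 hpq hwalk hS k t, fun f =>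
    generatorMapsTo_of_charFun hα0 hα1 hc (fun t => hS.measurable _) (fun t ξ => ?_) f⟩
  rw [hS.charFun_eq, coe_starTime d hα0]
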